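/- For an algebraic number $\alpha\in\overline{\mathbb{Q}}$ let $h(\alpha)$ denote its absolute logarithmic Weil height, and for a polynomial $f(z)=c\prod_{i=1}^d(z-\alpha_i)\in\overline{\mathbb{Q}}[z]$ of degree $d\ge 1$ put $h(f)=\frac1d\sum_{i=1}^d h(\alpha_i)$. A polynomial $f\in\overline{\mathbb{Q}}[z]$ is called conservative if every critical point $\gamma\in\overline{\mathbb{Q}}$ of $f$ satisfies $f(\gamma)=\gamma$. For $d\ge 2$ let $\mathcal{C}_d^{\mathrm{poly}}$ be the set of monic conservative polynomials $\phi\in\overline{\mathbb{Q}}[z]$ of degree $d$ with $\phi(0)=0$. Then for every $d\ge 2$ the maximum $\max_{\phi\in\mathcal{C}_d^{\mathrm{poly}}} \frac{h(\phi)}{(\log d)/d}$ exists, and $$\limsup_{d\to\infty}\ \max_{\phi\in\mathcal{C}_d^{\mathrm{poly}}}\ \frac{h(\phi)}{(\log d)/d}=\infty .$$ -/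

import Mathlib

open Polynomial Filter
open scoped IntermediateField

/-- Every element of the algebraic closure of `ℚ` is algebraic, stated for the `ℚ`-algebra
structure that instance search finds. -/
instance ratClosureIsAlgebraic : Algebra.IsAlgebraic ℚ (AlgebraicClosure ℚ) := by
  have h : (DivisionRing.toRatAlgebra : Algebra ℚ (AlgebraicClosure ℚ)) =
      AlgebraicClosure.instAlgebra ℚ := Subsingleton.elim _ _
  rw [h]
  exact AlgebraicClosure.isAlgebraic ℚ

/-- The field generated over `ℚ` by an algebraic number is a number field. -/
instance adjoinNumberField (α : AlgebraicClosure ℚ) : NumberField ℚ⟮α⟯ where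
  to_charZero := inferInstance
  to_finiteDimensional :=
    IntermediateField.adjoin.finiteDimensional (Algebra.IsAlgebraic.isAlgebraic α).isIntegral

/-- The absolute logarithmic Weil height of an algebraic number `α`: with `K = ℚ(α)`,
`h(α) = (1 / [K : ℚ]) * ∑ log max (‖α‖_v, 1)`, the sum over all places `v` of `K` with normalized
absolute values (`Height.logHeight₁` is the height relative to `K`). -/
noncomputable def absLogHeight (α : AlgebraicClosure ℚ) : ℝ :=
  Height.logHeight₁ (IntermediateField.AdjoinSimple.gen ℚ α) / (Module.finrank ℚ ℚ⟮α⟯ : ℝ)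

/-- The height of a polynomial over the algebraic numbers: the average of the absolute
logarithmic heights of its roots, counted with multiplicity. -/
noncomputable def polyHeight (f : (AlgebraicClosure ℚ)[X]) : ℝ :=
  (f.roots.map absLogHeight).sum / (f.natDegree : ℝ)

/-- A polynomial is conservative if each of its (finite) critical points is a fixed point. -/
def IsConservative (f : (AlgebraicClosure ℚ)[X]) : Prop :=
  ∀ γ : AlgebraicClosure ℚ, f.derivative.eval γ = 0 → f.eval γ = γ

/-- The monic conservative polynomials of degree `d` over the algebraic numbers that fix `0`. -/
def conservativePolys (d : ℕ) : Set (AlgebraicClosure ℚ)[X] :=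
  {f | f.natDegree = d ∧ f.Monic ∧ f.eval 0 = 0 ∧ IsConservative f}

/-! The limsup is forced by `(X - 1) ^ p + 1` for odd primes `p`. Its only critical point `1` is
fixed, and its roots are `1 - ζ` with `ζ ^ p = 1`. Each nonzero root has height at least `1/8`
(`one_div_eight_le_absLogHeight`), so the ratio is at least `(p - 1) / (8 log p)`, which is
unbounded.

The maximum exists because `conservativePolys d` is finite. Its members are determined by their
critical points, which satisfy equations (critical value `i`) = (critical point `i`) with
homogeneous sides of degrees `d` and `1`. The leading system has only the zero solution
(`eq_zero_of_forall_isRoot_polyOfCriticalPoints`), so there are no solutions at infinity, and hence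
only finitely many solutions. -/

/-! ### Heights of `1 - ζ` -/

lemma absLogHeight_nonneg (α : AlgebraicClosure ℚ) : 0 ≤ absLogHeight α :=
  div_nonneg (Height.zero_le_logHeight₁ _) (Nat.cast_nonneg _)

/-- The relative height is at least its archimedean part. -/
lemma sum_embeddings_posLog_le_logHeight₁ {K : Type*} [Field K] [NumberField K] (x : K) :
    ∑ σ : K →+* ℂ, Real.posLog ‖σ x‖ ≤ Height.logHeight₁ x := by
  classical
  rw [NumberField.logHeight₁_eq]
  have h1 : ∑ σ : K →+* ℂ, Real.posLog ‖σ x‖ =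
      ∑ v : NumberField.InfinitePlace K, v.mult * Real.posLog (v x) := by
    rw [← Finset.univ.sum_fiberwise (fun φ => NumberField.InfinitePlace.mk φ)]
    refine Finset.sum_congr rfl fun v _ => ?_
    rw [← NumberField.InfinitePlace.card_filter_mk_eq, ← nsmul_eq_mul, ← Finset.sum_const]
    refine Finset.sum_congr rfl fun φ hφ => ?_
    rw [← (Finset.mem_filter.mp hφ).2, NumberField.InfinitePlace.apply]
  rw [h1]
  exact le_add_of_nonneg_right (finsum_nonneg fun v => Real.posLog_nonneg)

/-- A bound linear in `r ^ 2`: for `r = ‖σ (1 - ζ)‖` it is linear in the real part of `σ ζ`, so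
summing over embeddings yields a trace. -/
lemma div_le_posLog_of_sq_le_four {r : ℝ} (h0 : 0 ≤ r) (h : r ^ 2 ≤ 4) :
    (r ^ 2 - 1) / 8 ≤ Real.posLog r := by
  rcases le_or_gt r 1 with h1 | h1
  · have : r ^ 2 ≤ 1 := by nlinarith
    exact le_trans (by linarith) Real.posLog_nonneg
  · refine le_trans ?_ (le_max_right _ _ : Real.log r ≤ _)
    have h2 := Real.one_sub_inv_le_log_of_pos (show 0 < r ^ 2 by positivity)
    rw [Real.log_pow] at h2
    have h3 : (r ^ 2 - 1) / 4 ≤ 1 - (r ^ 2)⁻¹ := by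
      have h4 : 1 - (r ^ 2)⁻¹ = (r ^ 2 - 1) / r ^ 2 := by field_simp
      rw [h4]
      exact div_le_div_of_nonneg_left (by nlinarith) (by positivity) h
    push_cast at h2
    linarith

/-- The minimal polynomial is `1 + X + ... + X ^ (p - 1)`, whose second coefficient is `1`. -/
lemma trace_rat_nonpos_of_isPrimitiveRoot {K : Type*} [Field K] [NumberField K] {p : ℕ}
    (hp : p.Prime) {ζ : K} (hζ : IsPrimitiveRoot ζ p) : Algebra.trace ℚ K ζ ≤ 0 := by
  have : Fact p.Prime := ⟨hp⟩
  rw [trace_eq_finrank_mul_minpoly_nextCoeff, ← Polynomial.cyclotomic_eq_minpoly_rat hζ hp.pos]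
  have hn : (cyclotomic p ℚ).nextCoeff = 1 := by
    have hd : (cyclotomic p ℚ).natDegree = p - 1 := by
      rw [natDegree_cyclotomic, Nat.totient_prime hp]
    have h2 := hp.two_le
    rw [nextCoeff_of_natDegree_pos (by omega), hd, cyclotomic_prime]
    simp [coeff_X_pow]
    omega
  rw [hn]
  simp

/-- If `ζ` is a root of unity of prime order, then `1 - ζ` has average archimedean size
bounded below, independently of the order. -/
lemma finrank_div_eight_le_logHeight₁_one_sub {K : Type*} [Field K] [NumberField K] {p : ℕ}
    (hp : p.Prime) {ζ : K} (hζ : IsPrimitiveRoot ζ p) :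
    (Module.finrank ℚ K : ℝ) / 8 ≤ Height.logHeight₁ (1 - ζ) := by
  refine le_trans ?_ (sum_embeddings_posLog_le_logHeight₁ (1 - ζ))
  have hnorm : ∀ σ : K →+* ℂ, ‖σ ζ‖ = 1 := fun σ =>
    (hζ.map_of_injective σ.injective).norm'_eq_one hp.ne_zero
  have hsq : ∀ σ : K →+* ℂ, ‖σ (1 - ζ)‖ ^ 2 = 2 - 2 * (σ ζ).re := fun σ => by
    have h1 := hnorm σ
    rw [← sq_eq_sq₀ (norm_nonneg _) zero_le_one, Complex.sq_norm, Complex.normSq_apply] at h1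
    rw [map_sub, map_one, Complex.sq_norm, Complex.normSq_apply, Complex.sub_re, Complex.sub_im,
      Complex.one_re, Complex.one_im]
    linarith
  have hle : ∀ σ : K →+* ℂ, (1 - 2 * (σ ζ).re) / 8 ≤ Real.posLog ‖σ (1 - ζ)‖ := fun σ => by
    have h1 : |(σ ζ).re| ≤ 1 := (Complex.abs_re_le_norm _).trans (hnorm σ).le
    have h2 := div_le_posLog_of_sq_le_four (norm_nonneg (σ (1 - ζ)))
      (by rw [hsq]; linarith [(abs_le.mp h1).1])
    rw [hsq] at h2
    linarith
  refine le_trans ?_ (Finset.sum_le_sum fun σ _ => hle σ)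
  have htr : ∑ σ : K →+* ℂ, (σ ζ).re = ((Algebra.trace ℚ K ζ : ℚ) : ℝ) := by
    have h1 := trace_eq_sum_embeddings (K := ℚ) ℂ (x := ζ)
    have h2 := congrArg Complex.re h1
    rw [Complex.re_sum] at h2
    rw [show ((algebraMap ℚ ℂ) ((Algebra.trace ℚ K) ζ)).re
      = ((Algebra.trace ℚ K ζ : ℚ) : ℝ) by simp] at h2
    rw [h2]
    exact Fintype.sum_equiv (RingHom.equivRatAlgHom K ℂ) _ _ fun σ => rfl
  have htr0 : ((Algebra.trace ℚ K ζ : ℚ) : ℝ) ≤ 0 := by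
    exact_mod_cast trace_rat_nonpos_of_isPrimitiveRoot hp hζ
  rw [← Finset.sum_div, Finset.sum_sub_distrib, ← Finset.mul_sum, htr, Finset.sum_const,
    Finset.card_univ, NumberField.Embeddings.card, nsmul_eq_mul, mul_one]
  linarith

lemma one_div_eight_le_absLogHeight {p : ℕ} (hp : p.Prime) {α : AlgebraicClosure ℚ}
    (h0 : α ≠ 0) (h : (1 - α) ^ p = 1) : 1 / 8 ≤ absLogHeight α := by
  set a := IntermediateField.AdjoinSimple.gen ℚ α with ha
  have hval : algebraMap ℚ⟮α⟯ (AlgebraicClosure ℚ) a = α :=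
    IntermediateField.AdjoinSimple.algebraMap_gen ℚ α
  have hinj := (algebraMap ℚ⟮α⟯ (AlgebraicClosure ℚ)).injective
  have hζ : IsPrimitiveRoot (1 - a) p := by
    have hne : 1 - a ≠ 1 := fun h1 => h0 (by rw [← hval, show a = 0 by linear_combination -h1,
      map_zero])
    have hpow : (1 - a) ^ p = 1 := hinj (by rw [map_pow, map_sub, map_one, hval, h])
    have : orderOf (1 - a) = p := haveI := Fact.mk hp
      orderOf_eq_prime hpow hne
    exact this ▸ IsPrimitiveRoot.orderOf (1 - a)
  have key := finrank_div_eight_le_logHeight₁_one_sub hp hζ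
  rw [sub_sub_cancel] at key
  have hpos : (0 : ℝ) < Module.finrank ℚ ℚ⟮α⟯ := by exact_mod_cast Module.finrank_pos
  rw [absLogHeight, le_div_iff₀ hpos]
  linarith

/-! ### The unicritical family -/

section Unicritical

variable {p : ℕ}

lemma natDegree_X_sub_one_pow_add_one :
    ((X - 1 : (AlgebraicClosure ℚ)[X]) ^ p + 1).natDegree = p := by
  rw [← C_1, natDegree_add_C, natDegree_pow, natDegree_X_sub_C, mul_one]

lemma X_sub_one_pow_add_one_mem_conservativePolys (hodd : Odd p) (h2 : 2 ≤ p) :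
    (X - 1 : (AlgebraicClosure ℚ)[X]) ^ p + 1 ∈ conservativePolys p := by
  refine ⟨natDegree_X_sub_one_pow_add_one, ?_, ?_, ?_⟩
  · have : ((X - C 1 : (AlgebraicClosure ℚ)[X]) ^ p).Monic := (monic_X_sub_C 1).pow p
    rw [C_1] at this
    refine this.add_of_left ?_
    rw [degree_one, ← C_1, degree_pow, degree_X_sub_C, nsmul_one]
    exact_mod_cast (by omega : 0 < p)
  · simp [hodd.neg_one_pow]
  · intro γ hγ
    have hp0 : (p : AlgebraicClosure ℚ) ≠ 0 := by exact_mod_cast (by omega : p ≠ 0)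
    simp [derivative_pow, hp0] at hγ
    have h1 : γ = 1 := sub_eq_zero.mp hγ.1
    subst h1
    simp
    omega

lemma le_polyHeight_X_sub_one_pow_add_one (hp : p.Prime) (hodd : Odd p) :
    ((p : ℝ) - 1) / 8 / p ≤ polyHeight ((X - 1 : (AlgebraicClosure ℚ)[X]) ^ p + 1) := by
  classical
  set f : (AlgebraicClosure ℚ)[X] := (X - 1) ^ p + 1 with hf
  have hdeg : f.natDegree = p := natDegree_X_sub_one_pow_add_one
  have hf0 : f ≠ 0 := fun h => hp.ne_zero (by rw [← hdeg, h, natDegree_zero])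
  have hp0 : (p : AlgebraicClosure ℚ) ≠ 0 := by exact_mod_cast hp.ne_zero
  have hsep : f.Separable := by
    -- Bézout identity `f - (X - 1) f' / p = 1`.
    refine ⟨1, -C ((p : AlgebraicClosure ℚ)⁻¹) * (X - 1), ?_⟩
    have hd : derivative f = C (p : AlgebraicClosure ℚ) * (X - 1) ^ (p - 1) := by
      simp [hf, derivative_pow]
    have hC : C ((p : AlgebraicClosure ℚ)⁻¹) * C (p : AlgebraicClosure ℚ) = 1 := by
      rw [← C_mul, inv_mul_cancel₀ hp0, C_1]
    have hpw : (X - 1 : (AlgebraicClosure ℚ)[X]) * (X - 1) ^ (p - 1) = (X - 1) ^ p := by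
      rw [← pow_succ', Nat.sub_add_cancel hp.one_le]
    rw [hd, hf]
    linear_combination (-(X - 1) * (X - 1) ^ (p - 1)) * hC - hpw
  have hnodup : f.roots.Nodup := nodup_roots hsep
  have hcard : f.roots.card = p := by
    rw [← hdeg]; exact (IsAlgClosed.splits f).natDegree_eq_card_roots.symm
  rw [polyHeight, hdeg]
  gcongr
  have hsum : (f.roots.map absLogHeight).sum = ∑ α ∈ f.roots.toFinset, absLogHeight α := by
    rw [Finset.sum, Multiset.toFinset_val, hnodup.dedup]
  have hroot0 : (0 : AlgebraicClosure ℚ) ∈ f.roots.toFinset := by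
    rw [Multiset.mem_toFinset, mem_roots hf0]
    simp [hf, IsRoot, hodd.neg_one_pow]
  rw [hsum, ← Finset.add_sum_erase _ _ hroot0]
  refine le_trans ?_ (le_add_of_nonneg_left (absLogHeight_nonneg 0))
  have hle : (f.roots.toFinset.erase 0).card • (1 / 8 : ℝ) ≤
      ∑ α ∈ f.roots.toFinset.erase 0, absLogHeight α := by
    refine Finset.card_nsmul_le_sum _ _ _ fun α hα => ?_
    rw [Finset.mem_erase, Multiset.mem_toFinset, mem_roots hf0] at hα
    refine one_div_eight_le_absLogHeight hp hα.1 ?_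
    have h1 : (α - 1) ^ p + 1 = 0 := by simpa [hf, IsRoot] using hα.2
    rw [← neg_sub, hodd.neg_pow]
    linear_combination -h1
  rw [Finset.card_erase_of_mem hroot0, Multiset.toFinset_card_of_nodup hnodup, hcard,
    nsmul_eq_mul, Nat.cast_sub hp.one_le] at hle
  push_cast at hle
  linarith

end Unicritical

/-! ### Finiteness for systems without solutions at infinity -/

section Finiteness

namespace MvPolynomial

variable {σ K A : Type*} [Field K] [CommRing A] [Algebra K A]

/-- The image under `ev` of the polynomials of total degree less than `m`. -/
def imageDegreeLT (ev : MvPolynomial σ K →ₐ[K] A) (m : ℕ) : Submodule K A :=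
  Submodule.span K ((fun s => ev (monomial s 1)) '' {s | s.degree < m})

lemma map_monomial_mem_imageDegreeLT (ev : MvPolynomial σ K →ₐ[K] A) {m : ℕ} {s : σ →₀ ℕ}
    (hs : s.degree < m) : ev (monomial s 1) ∈ imageDegreeLT ev m :=
  Submodule.subset_span ⟨s, hs, rfl⟩

lemma map_mem_of_forall_monomial_mem (ev : MvPolynomial σ K →ₐ[K] A) {W : Submodule K A}
    {p : MvPolynomial σ K} (hp : ∀ s ∈ p.support, ev (monomial s 1) ∈ W) : ev p ∈ W := by
  rw [p.as_sum, map_sum]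
  refine Submodule.sum_mem _ fun s hs => ?_
  rw [← mul_one (coeff s p), ← smul_eq_mul, ← smul_monomial, map_smul]
  exact W.smul_mem _ (hp s hs)

lemma IsHomogeneous.map_mem_imageDegreeLT (ev : MvPolynomial σ K →ₐ[K] A) {m n : ℕ}
    {p : MvPolynomial σ K} (hp : p.IsHomogeneous n) (h : n < m) : ev p ∈ imageDegreeLT ev m :=
  map_mem_of_forall_monomial_mem ev fun s hs =>
    map_monomial_mem_imageDegreeLT ev (by
      
      have h1 : s.degree = n := by
        rw [Finsupp.degree_eq_weight_one]
        exact hp (mem_support_iff.mp hs)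
      exact h1.trans_lt h)

lemma map_monomial_mul_mem_imageDegreeLT (ev : MvPolynomial σ K →ₐ[K] A) {m : ℕ} (s : σ →₀ ℕ)
    {x : A} (hx : x ∈ imageDegreeLT ev m) :
    ev (monomial s 1) * x ∈ imageDegreeLT ev (s.degree + m) := by
  induction hx using Submodule.span_induction with
  | mem x hx =>
    obtain ⟨t, ht, rfl⟩ := hx
    simp only [← map_mul, monomial_mul, mul_one]
    refine map_monomial_mem_imageDegreeLT ev ?_
    rw [map_add]
    exact Nat.add_lt_add_left ht _
  | zero => simp
  | add x y _ _ hx hy => rw [mul_add]; exact Submodule.add_mem _ hx hy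
  | smul a x _ hx => rw [mul_smul_comm]; exact Submodule.smul_mem _ _ hx

/-- A monomial with some exponent at least `N` can be rewritten in lower degree. By induction the
monomials with all exponents below `N` span the range of `ev`, which is thus finite-dimensional. -/
lemma isIntegral_of_pow_mem_imageDegreeLT [Finite σ] (ev : MvPolynomial σ K →ₐ[K] A) {N : ℕ}
    (h : ∀ j, ev (X j ^ N) ∈ imageDegreeLT ev N) (p : MvPolynomial σ K) : IsIntegral K (ev p) := by
  classical
  set S : Set (σ →₀ ℕ) := {s | ∀ j, s j < N}
  set W : Submodule K A := Submodule.span K ((fun s => ev (monomial s 1)) '' S) with hW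
  have hS : S.Finite := (Set.finite_Iic (Finsupp.equivFunOnFinite.symm fun _ => N)).subset
    fun s hs j => (hs j).le
  have hWfg : W.FG := Submodule.fg_span (hS.image _)
  have hmem : ∀ m, imageDegreeLT ev m ≤ W := by
    intro m
    induction m with
    | zero => exact Submodule.span_le.mpr (by rintro _ ⟨s, hs, rfl⟩; exact absurd hs (by simp))
    | succ m ih =>
      refine Submodule.span_le.mpr ?_
      rintro _ ⟨s, hs, rfl⟩
      by_cases hsS : s ∈ S
      · exact Submodule.subset_span ⟨s, hsS, rfl⟩
      · simp only [S, Set.mem_ofPred_eq, not_forall, not_lt] at hsS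
        obtain ⟨j, hj⟩ := hsS
        obtain ⟨t, rfl⟩ : ∃ t, s = t + Finsupp.single j N :=
          ⟨s - Finsupp.single j N, (tsub_add_cancel_of_le (by simpa using hj)).symm⟩
        have h1 := map_monomial_mul_mem_imageDegreeLT ev t (h j)
        rw [← map_mul, X_pow_eq_monomial, monomial_mul, mul_one] at h1
        refine ih (Submodule.span_mono (Set.image_mono fun u hu => ?_) h1)
        simp only [Set.mem_ofPred_eq, map_add, Finsupp.degree_single] at hs hu ⊢
        omega
  have hrange : ev.range.toSubmodule ≤ W := by
    rintro _ ⟨q, rfl⟩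
    exact map_mem_of_forall_monomial_mem ev fun s _ =>
      hmem (s.degree + 1) (map_monomial_mem_imageDegreeLT ev (Nat.lt_succ_self _))
  have hfg : ev.range.toSubmodule.FG := by
    have : Module.Finite K W := Module.Finite.iff_fg.mpr hWfg
    exact Module.Finite.iff_fg.mp (Submodule.finiteDimensional_of_le hrange)
  exact IsIntegral.of_mem_of_fg ev.range hfg _ ⟨p, rfl⟩

/-- If `G i - F i` has lower degree than the homogeneous `G i` and `ev` kills all `F i`, then
`ev` maps homogeneous components of elements of the ideal `(G i)` to images of polynomials of
lower degree. -/
lemma map_homogeneousComponent_mem_imageDegreeLT {ι : Type*} [Finite ι]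
    (ev : MvPolynomial σ K →ₐ[K] A) {e e' : ℕ} (he : e' < e) {G H : ι → MvPolynomial σ K}
    (hG : ∀ i, (G i).IsHomogeneous e) (hH : ∀ i, (H i).IsHomogeneous e')
    (hGH : ∀ i, ev (G i) = ev (H i)) {q : MvPolynomial σ K} (hq : q ∈ Ideal.span (Set.range G))
    (N : ℕ) : ev (homogeneousComponent N q) ∈ imageDegreeLT ev N := by
  have := Fintype.ofFinite ι
  obtain ⟨c, rfl⟩ := Ideal.mem_span_range_iff_exists_fun.mp hq
  rw [map_sum, map_sum]
  refine Submodule.sum_mem _ fun i _ => ?_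
  rw [← sum_homogeneousComponent (c i), Finset.sum_mul, map_sum, map_sum]
  refine Submodule.sum_mem _ fun k _ => ?_
  have hk := homogeneousComponent_isHomogeneous k (c i)
  rw [homogeneousComponent_of_mem (hk.mul (hG i))]
  split_ifs with h
  -- Trading `G i` for `H i` lowers the degree by `e - e'`.
  · rw [map_mul, hGH, ← map_mul]
    exact (hk.mul (hH i)).map_mem_imageDegreeLT ev (by omega)
  · simp

/-- A system of equations `G i = H i` with homogeneous sides of degrees `e > e'` has finitely
many solutions if the leading system `G i = 0` has only the trivial one. -/
theorem finite_setOf_eval_eq_of_homogeneous [IsAlgClosed K] [Finite σ] {ι : Type*} [Finite ι]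
    {e e' : ℕ} (he : e' < e) {G H : ι → MvPolynomial σ K}
    (hG : ∀ i, (G i).IsHomogeneous e) (hH : ∀ i, (H i).IsHomogeneous e')
    (h0 : ∀ x : σ → K, (∀ i, eval x (G i) = 0) → x = 0) :
    {x : σ → K | ∀ i, eval x (G i) = eval x (H i)}.Finite := by
  have := Fintype.ofFinite σ
  set V := {x : σ → K | ∀ i, eval x (G i) = eval x (H i)}
  set I := Ideal.span (Set.range G)
  -- Nullstellensatz: the zero locus of `I` lies in the origin.
  have hrad : ∀ j, X j ∈ I.radical := fun j => by
    rw [← vanishingIdeal_zeroLocus_eq_radical (K := K), mem_vanishingIdeal_iff]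
    intro x hx
    have : x = 0 := h0 x fun i => by
      have := hx (G i) (Ideal.subset_span ⟨i, rfl⟩)
      rwa [aeval_eq_eval] at this
    simp [this]
  choose n hn using hrad
  set N := ∑ j, n j
  have hN : ∀ j, (X j ^ N : MvPolynomial σ K) ∈ I := fun j =>
    I.pow_mem_of_pow_mem (hn j) (Finset.single_le_sum (fun _ _ => Nat.zero_le _)
      (Finset.mem_univ j))
  -- In the ring of functions on `V`, integrality of a coordinate confines its values to the roots
  -- of one polynomial.
  set ev : MvPolynomial σ K →ₐ[K] (V → K) := AlgHom.pi fun x => aeval x.1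
  have hev : ∀ p x, ev p x = eval x.1 p := fun p x => by simp [ev, aeval_eq_eval]
  have hGH : ∀ i, ev (G i) = ev (H i) := fun i => by
    funext x
    rw [hev, hev]
    exact x.2 i
  have hint : ∀ j, IsIntegral K (ev (X j)) := fun j => by
    refine isIntegral_of_pow_mem_imageDegreeLT ev (N := N) (fun j => ?_) _
    rw [← homogeneousComponent_eq_self (isHomogeneous_X_pow j N)]
    exact map_homogeneousComponent_mem_imageDegreeLT ev he hG hH hGH
      (hN j) N
  choose P hPm hP using hint
  classical
  refine (Set.Finite.pi' fun j => (P j).roots.toFinset.finite_toSet).subset fun x hx j => ?_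
  rw [Finset.mem_coe, Multiset.mem_toFinset, mem_roots (hPm j).ne_zero, IsRoot]
  have h1 : Polynomial.aeval (Pi.evalAlgHom K (fun _ : V => K) ⟨x, hx⟩ (ev (X j))) (P j) = 0 := by
    rw [Polynomial.aeval_algHom_apply, Polynomial.aeval_def, hP j, map_zero]
  rwa [Polynomial.coe_aeval_eq_eval, Pi.evalAlgHom_apply, hev, eval_X] at h1

end MvPolynomial

/-! ### Polynomials parametrized by their critical points -/

variable {K : Type*} [Field K]

/-- The polynomial vanishing at `0` with derivative `(n + 1) * ∏ (X - g j)`. -/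
noncomputable def polyOfCriticalPoints {n : ℕ} (g : Fin n → K) : K[X] :=
  ∑ k ∈ Finset.range (n + 1),
    C ((n + 1 : K) / (k + 1) * (∏ j, (X - C (g j))).coeff k) * X ^ (k + 1)

lemma natDegree_prod_X_sub_C_fin {n : ℕ} (g : Fin n → K) : (∏ j, (X - C (g j))).natDegree = n := by
  rw [natDegree_prod_of_monic _ _ fun j _ => monic_X_sub_C _]
  simp

lemma derivative_polyOfCriticalPoints [CharZero K] {n : ℕ} (g : Fin n → K) :
    derivative (polyOfCriticalPoints g) = C (n + 1 : K) * ∏ j, (X - C (g j)) := by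
  conv_rhs => rw [(∏ j, (X - C (g j)) : K[X]).as_sum_range_C_mul_X_pow, natDegree_prod_X_sub_C_fin]
  rw [polyOfCriticalPoints, derivative_sum, Finset.mul_sum]
  refine Finset.sum_congr rfl fun k _ => ?_
  have hk : (k + 1 : K) ≠ 0 := Nat.cast_add_one_ne_zero k
  rw [derivative_C_mul_X_pow, Nat.add_sub_cancel, ← mul_assoc, ← C_mul]
  congr 2
  push_cast
  field_simp

lemma eval_zero_polyOfCriticalPoints {n : ℕ} (g : Fin n → K) :
    (polyOfCriticalPoints g).eval 0 = 0 := by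
  simp [polyOfCriticalPoints, eval_finsetSum]

lemma natDegree_polyOfCriticalPoints_le {n : ℕ} (g : Fin n → K) :
    (polyOfCriticalPoints g).natDegree ≤ n + 1 :=
  natDegree_sum_le_of_forall_le _ _ fun k hk =>
    (natDegree_C_mul_X_pow_le _ _).trans (by simpa [Nat.lt_succ_iff] using hk)

lemma prod_X_sub_C_eq_multiset_prod {n : ℕ} (g : Fin n → K) :
    ∏ j, (X - C (g j)) = ((Finset.univ.val.map g).map fun t => X - C t).prod := by
  rw [Multiset.map_map]; rfl

/-- If all critical points of the polynomial are among its zeros, they are all equal to `0`. -/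
lemma eq_zero_of_forall_isRoot_polyOfCriticalPoints [CharZero K] {n : ℕ} (g : Fin n → K)
    (h : ∀ i, (polyOfCriticalPoints g).eval (g i) = 0) : g = 0 := by
  classical
  set f := polyOfCriticalPoints g with hf
  have hn : (n + 1 : K) ≠ 0 := Nat.cast_add_one_ne_zero n
  have hd : derivative f = C (n + 1 : K) * ∏ j, (X - C (g j)) := derivative_polyOfCriticalPoints g
  have hroots : (derivative f).roots = Finset.univ.val.map g := by
    rw [hd, roots_C_mul _ hn, prod_X_sub_C_eq_multiset_prod, roots_multiset_prod_X_sub_C]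
  have hd0 : derivative f ≠ 0 := by
    rw [hd]
    exact mul_ne_zero (C_ne_zero.mpr hn) (Finset.prod_ne_zero_iff.mpr fun j _ => X_sub_C_ne_zero _)
  have hf0 : f ≠ 0 := fun h => hd0 (by rw [h, derivative_zero])
  set T : Finset K := insert 0 (Finset.univ.image g) with hT
  have hTroot : ∀ t ∈ T, f.IsRoot t := by
    intro t ht
    rcases Finset.mem_insert.mp ht with rfl | ht
    · exact eval_zero_polyOfCriticalPoints g
    · obtain ⟨i, -, rfl⟩ := Finset.mem_image.mp ht
      exact h i
  -- On `T` each multiplicity in `f` is one more than in `f'`, so they total `n + T.card`; the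
  -- degree bound leaves `T = {0}`.
  have h1 : ∑ t ∈ T, f.roots.count t ≤ n + 1 := by
    refine le_trans ?_ ((card_roots' f).trans (natDegree_polyOfCriticalPoints_le g))
    rw [← Multiset.toFinset_sum_count_eq]
    exact Finset.sum_le_sum_of_subset fun t ht =>
      Multiset.mem_toFinset.mpr ((mem_roots hf0).mpr (hTroot t ht))
  have h2 : ∑ t ∈ T, (derivative f).roots.count t = n := by
    rw [Multiset.sum_count_eq_card (s := T) (m := (derivative f).roots), hroots]
    · simp
    · intro t ht
      rw [hroots, Multiset.mem_map] at ht
      obtain ⟨i, -, rfl⟩ := ht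
      exact Finset.mem_insert_of_mem (Finset.mem_image_of_mem g (Finset.mem_univ i))
  have h3 : ∑ t ∈ T, f.roots.count t = ∑ t ∈ T, ((derivative f).roots.count t + 1) := by
    refine Finset.sum_congr rfl fun t ht => ?_
    rw [count_roots, count_roots, derivative_rootMultiplicity_of_root (hTroot t ht)]
    have := (rootMultiplicity_pos hf0).mpr (hTroot t ht)
    omega
  rw [h3, Finset.sum_add_distrib, h2, Finset.sum_const, smul_eq_mul, mul_one] at h1
  have hcard : T.card ≤ 1 := by omega
  funext i
  exact Finset.card_le_one.mp hcard _
    (Finset.mem_insert_of_mem (Finset.mem_image_of_mem g (Finset.mem_univ i))) _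
    (Finset.mem_insert_self _ _)

/-- The critical value at the `i`-th critical point, as a polynomial in the critical points. -/
noncomputable def criticalValue (K : Type*) [Field K] {n : ℕ} (i : Fin n) :
    MvPolynomial (Fin n) K :=
  ∑ k ∈ Finset.range (n + 1),
    MvPolynomial.C ((n + 1 : K) / (k + 1) * (-1) ^ (n - k)) *
      MvPolynomial.esymm (Fin n) K (n - k) * MvPolynomial.X i ^ (k + 1)

lemma MvPolynomial.isHomogeneous_esymm (σ R : Type*) [Fintype σ] [CommSemiring R] (k : ℕ) :
    (MvPolynomial.esymm σ R k).IsHomogeneous k := by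
  refine MvPolynomial.IsHomogeneous.sum _ _ _ fun s hs => ?_
  have := MvPolynomial.IsHomogeneous.prod s (fun i => (MvPolynomial.X i : MvPolynomial σ R))
    (fun _ => 1) fun i _ => MvPolynomial.isHomogeneous_X R i
  simpa [(Finset.mem_powersetCard.mp hs).2] using this

lemma isHomogeneous_criticalValue {n : ℕ} (i : Fin n) :
    (criticalValue K i).IsHomogeneous (n + 1) := by
  refine MvPolynomial.IsHomogeneous.sum _ _ _ fun k hk => ?_
  have h := ((MvPolynomial.isHomogeneous_C (Fin n)
    ((n + 1 : K) / (k + 1) * (-1) ^ (n - k))).mul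
    (MvPolynomial.isHomogeneous_esymm (Fin n) K (n - k))).mul
    (MvPolynomial.isHomogeneous_X_pow (R := K) i (k + 1))
  have hk' := Finset.mem_range.mp hk
  rwa [show 0 + (n - k) + (k + 1) = n + 1 by omega] at h

lemma eval_criticalValue {n : ℕ} (g : Fin n → K) (i : Fin n) :
    MvPolynomial.eval g (criticalValue K i) = (polyOfCriticalPoints g).eval (g i) := by
  rw [criticalValue, polyOfCriticalPoints, map_sum, eval_finsetSum]
  refine Finset.sum_congr rfl fun k hk => ?_
  have hk' := Finset.mem_range.mp hk
  have hc : (∏ j, (X - C (g j))).coeff k =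
      (-1) ^ (n - k) * (Finset.univ.val.map g).esymm (n - k) := by
    rw [prod_X_sub_C_eq_multiset_prod, Multiset.prod_X_sub_C_coeff _ (by simp; omega)]
    simp
  have he := MvPolynomial.aeval_esymm_eq_multiset_esymm (σ := Fin n) (R := K) (n - k) g
  rw [MvPolynomial.aeval_eq_eval] at he
  simp only [map_mul, map_pow, MvPolynomial.eval_C, MvPolynomial.eval_X, eval_mul, eval_C,
    eval_pow, eval_X]
  rw [he, hc]
  ring

lemma exists_fin_map_eq {α : Type*} {n : ℕ} (s : Multiset α) (hs : s.card = n) :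
    ∃ g : Fin n → α, Finset.univ.val.map g = s := by
  subst hs
  induction s using Quotient.inductionOn with
  | h l => exact ⟨l.get, (Fin.univ_val_map l.get).trans (congrArg _ (List.ofFn_get l))⟩

lemma exists_eq_polyOfCriticalPoints [CharZero K] [IsAlgClosed K] {n : ℕ} {f : K[X]} (hm : f.Monic)
    (hd : f.natDegree = n + 1) (h0 : f.eval 0 = 0) :
    ∃ g : Fin n → K, f = polyOfCriticalPoints g := by
  have hn : (n + 1 : K) ≠ 0 := Nat.cast_add_one_ne_zero n
  have hdeg : (derivative f).natDegree = n := by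
    rw [natDegree_derivative, hd, Nat.add_sub_cancel]
  have hlead : (derivative f).leadingCoeff = n + 1 := by
    rw [leadingCoeff, hdeg, coeff_derivative, ← hd, coeff_natDegree, hm.leadingCoeff, one_mul]
  have hsplit := IsAlgClosed.splits (derivative f)
  obtain ⟨g, hg⟩ := exists_fin_map_eq (n := n) (derivative f).roots
    (by rw [← hdeg]; exact hsplit.natDegree_eq_card_roots.symm)
  refine ⟨g, ?_⟩
  have hder : derivative (f - polyOfCriticalPoints g) = 0 := by
    rw [derivative_sub, derivative_polyOfCriticalPoints, prod_X_sub_C_eq_multiset_prod, hg, ← hlead,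
      ← hsplit.eq_prod_roots, sub_self]
  have h1 := eq_C_of_derivative_eq_zero hder
  rw [coeff_zero_eq_eval_zero, eval_sub, h0, eval_zero_polyOfCriticalPoints, sub_zero, C_0] at h1
  exact sub_eq_zero.mp h1

end Finiteness

/-! ### Existence of the maximum and divergence -/

theorem finite_conservativePolys {d : ℕ} (hd : 2 ≤ d) : (conservativePolys d).Finite := by
  obtain ⟨n, rfl⟩ : ∃ n, d = n + 1 := ⟨d - 1, by omega⟩
  have hfin := MvPolynomial.finite_setOf_eval_eq_of_homogeneous (K := AlgebraicClosure ℚ)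
    (σ := Fin n) (e' := 1) (by omega : 1 < n + 1) isHomogeneous_criticalValue
    (fun i => MvPolynomial.isHomogeneous_X _ i) fun g hg =>
      eq_zero_of_forall_isRoot_polyOfCriticalPoints g fun i => by rw [← eval_criticalValue, hg]
  refine (hfin.image polyOfCriticalPoints).subset ?_
  rintro f ⟨hdeg, hm, h0, hcons⟩
  obtain ⟨g, rfl⟩ := exists_eq_polyOfCriticalPoints hm hdeg h0
  refine ⟨g, fun i => ?_, rfl⟩
  rw [eval_criticalValue, MvPolynomial.eval_X]
  refine hcons _ ?_
  rw [derivative_polyOfCriticalPoints, eval_mul, eval_prod,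
    Finset.prod_eq_zero (Finset.mem_univ i) (by simp), mul_zero]

lemma conservativePolys_nonempty {d : ℕ} (hd : 2 ≤ d) : (conservativePolys d).Nonempty := by
  refine ⟨X ^ d, natDegree_X_pow d, monic_X_pow d, by simp; omega, fun γ hγ => ?_⟩
  have hd0 : (d : AlgebraicClosure ℚ) ≠ 0 := by exact_mod_cast (by omega : d ≠ 0)
  simp only [derivative_X_pow, eval_mul, eval_C, eval_pow, eval_X, mul_eq_zero, hd0,
    false_or] at hγ
  rw [eq_zero_of_pow_eq_zero hγ, eval_pow, eval_X, zero_pow (by omega)]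

lemma exists_prime_odd_le_div_log (B : ℝ) (n : ℕ) :
    ∃ p ≥ n, p.Prime ∧ Odd p ∧ B ≤ ((p : ℝ) - 1) / 8 / Real.log p := by
  -- Once `C * log p ≤ p`, also `8 * |B| * log p ≤ p / 2 ≤ p - 1`.
  set C : ℝ := 16 * (|B| + 1)
  have hC : 0 < C := by positivity
  have h := (Real.isLittleO_log_id_atTop.def (inv_pos.mpr hC)).natCast_atTop
  obtain ⟨m, hm⟩ := eventually_atTop.mp h
  obtain ⟨p, hp, hprime⟩ := Nat.exists_infinite_primes (max (max n m) 3)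
  have hpn : n ≤ p := by omega
  have hpm : m ≤ p := by omega
  have hp3 : 3 ≤ p := by omega
  refine ⟨p, hpn, hprime, hprime.odd_of_ne_two (by omega), ?_⟩
  have hp3' : (3 : ℝ) ≤ p := by exact_mod_cast hp3
  have hlog : 0 < Real.log p := Real.log_pos (by linarith)
  have h1 := hm p hpm
  rw [Real.norm_of_nonneg hlog.le, id, Real.norm_of_nonneg (by linarith), inv_mul_eq_div,
    le_div_iff₀ hC] at h1
  rw [le_div_iff₀ hlog]
  have h2 : B * Real.log p ≤ |B| * Real.log p := by gcongr; exact le_abs_self B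
  simp only [C] at h1
  nlinarith

theorem theorem2 :
    ∃ M : ℕ → ℝ,
      (∀ d : ℕ, 2 ≤ d →
        IsGreatest
          ((fun φ : (AlgebraicClosure ℚ)[X] => polyHeight φ / (Real.log (d : ℝ) / (d : ℝ))) ''
            conservativePolys d)
          (M d)) ∧
      limsup (fun d : ℕ => ((M d : ℝ) : EReal)) atTop = ⊤ := by
  have hmax : ∀ d : ℕ, ∃ m : ℝ, 2 ≤ d → IsGreatest
      ((fun φ : (AlgebraicClosure ℚ)[X] => polyHeight φ / (Real.log (d : ℝ) / (d : ℝ))) ''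
        conservativePolys d) m := fun d => by
    by_cases hd : 2 ≤ d
    · obtain ⟨φ, hφ, hle⟩ := Set.exists_max_image _
        (fun φ => polyHeight φ / (Real.log (d : ℝ) / (d : ℝ)))
        (finite_conservativePolys hd) (conservativePolys_nonempty hd)
      exact ⟨_, fun _ => ⟨⟨φ, hφ, rfl⟩, by rintro _ ⟨ψ, hψ, rfl⟩; exact hle ψ hψ⟩⟩
    -- An arbitrary value: the limsup ignores `d < 2`.
    · exact ⟨0, fun h => absurd h hd⟩
  choose M hM using hmax
  refine ⟨M, hM, ?_⟩
  rw [EReal.eq_top_iff_forall_lt]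
  intro B
  refine lt_of_lt_of_le (EReal.coe_lt_coe_iff.mpr (lt_add_one B)) (le_limsup_of_frequently_le' ?_)
  refine frequently_atTop.mpr fun n => ?_
  obtain ⟨p, hpn, hp, hodd, hB⟩ := exists_prime_odd_le_div_log (B + 1) n
  refine ⟨p, hpn, EReal.coe_le_coe_iff.mpr (hB.trans ?_)⟩
  refine le_trans ?_ ((hM p hp.two_le).2
    ⟨_, X_sub_one_pow_add_one_mem_conservativePolys hodd hp.two_le, rfl⟩)
  have hp1 : (1 : ℝ) < p := by exact_mod_cast hp.one_lt
  have hlog : 0 < Real.log p := Real.log_pos hp1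
  have hle := le_polyHeight_X_sub_one_pow_add_one hp hodd
  calc ((p : ℝ) - 1) / 8 / Real.log p = ((p : ℝ) - 1) / 8 / p / (Real.log p / p) := by
        field_simp
    _ ≤ _ := div_le_div_of_nonneg_right hle (div_pos hlog (by linarith)).le
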